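/- **Theorem (tropical Jacobi inversion).** Let $C$ be a compact tropical curve of genus $g$, that is, the geometric realization of a finite connected metric graph (loops and multiple edges allowed) whose edges have length in $(0,\infty)$, except that leaves may have length $\infty$, in which case their 1-valent end is a point at infinity; $g$ is the first Betti number of $C$. Let $\Omega(C)$ be the real vector space of 1-forms on $C$ (forms $\omega$ that are constant along edges and satisfy $\sum_\xi\omega(\xi)=0$ at every point $p$, the sum being over the outward primitive tangent vectors $\xi$ at $p$). Let $\Lambda\subset\Omega(C)^*$ be the image of $H_1(C,\mathbb Z)$ under integration, and let $J(C)=\Omega(C)^*/\Lambda$. Let $Q$ be the bilinear form on $H_1(C,\mathbb Z)$ with $Q(\sum_E a_E E,\sum_E b_E E)=\sum_E a_E b_E\,\mathrm{length}(E)$ (only edges of finite length contribute), extended linearly to $\Omega(C)^*$ by means of $H_1(C,\mathbb Z)\cong\Lambda$, and let $$\Theta(x)=\max_{\gamma\in\Lambda}\bigl\{Q(\gamma,x)-\tfrac12Q(\gamma,\gamma)\bigr\},\qquad \Theta_\lambda(x)=\Theta(x-\lambda),\qquad x,\lambda\in\Omega(C)^* .$$ Fix a point $p_0\in C$ and let $\mu$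 be the Abel-Jacobi map $\mu(\sum_i a_ip_i)=\sum_i a_i\int_{p_0}^{p_i}\in J(C)$ on divisors, in particular $\mu:C\to J(C)$ on points. For $\lambda\in J(C)$ let $D_\lambda=\mu^*[\Theta_\lambda]$ be the divisor on $C$ whose multiplicity at a point $p$ is the sum of the slopes of $\Theta_{\tilde\lambda}\circ\hat\mu$ at $p$ along the outward primitive tangent vectors at $p$, where $\hat\mu$ is a lift of $\mu$ to $\Omega(C)^*$ near $p$ and $\tilde\lambda\in\Omega(C)^*$ is a lift of $\lambda$. Then for every $\lambda\in J(C)$ the divisor $D_\lambda$ is well defined (the slopes are integers, the multiplicities do not depend on the choice of the lifts, and only finitely many of them are non-zero), effective, and of degree $g$. Moreover there is a $\kappa\in J(C)$, independent of $\lambda$, such that $$\mu(D_\lambda)+\kappa=\lambda\qquad\text{for all }\lambda\in J(C).$$ -/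

import Mathlib

open scoped ENNReal

noncomputable section

/-- A finite graph with vertex set `V`, edge set `E` (loops and multiple edges are allowed) and
edge lengths in `(0, ∞]`. Every edge `e` is oriented and carries an arc-length parameter in
`[0, len e]`, with value `0` at `src e` and value `len e` at `tgt e`. An edge of infinite length
has to be a leaf, whose point at infinity is the 1-valent vertex `tgt e`. (Leaves of finite length
are allowed as well. A leaf with infinite ends on both sides is subdivided by a 2-valent vertex.) -/
structure MetricGraph (V E : Type*) [Fintype V] [Fintype E] where
  src : E → V
  tgt : E → V
  len : E → ℝ≥0∞
  len_pos : ∀ e, 0 < len e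
  leaf_of_len_eq_top : ∀ e, len e = ⊤ →
    {e' | src e' = tgt e}.ncard + {e' | tgt e' = tgt e}.ncard = 1

namespace MetricGraph

variable {V E : Type*} [Fintype V] [Fintype E] (G : MetricGraph V E)

/-- The points of the geometric realization: vertices, and interior points of edges given by
their arc-length parameter. -/
inductive Point : Type _
  | vertex (v : V) : Point
  | inner (e : E) (t : ℝ≥0∞) (pos : 0 < t) (lt : t < G.len e) : Point

/-- The point with parameter `a ∈ [0, len e]` on the edge `e`. -/
def pt (e : E) (a : ℝ≥0∞) : G.Point :=
  if h : 0 < a ∧ a < G.len e then .inner e a h.1 h.2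
  else if a = 0 then .vertex (G.src e) else .vertex (G.tgt e)

/-- An oriented segment of an edge, running from parameter `a` to parameter `b`. -/
structure Seg (E : Type*) where
  edge : E
  a : ℝ≥0∞
  b : ℝ≥0∞

/-- `G.IsPath γ p q`: the list `γ` of segments is a (piecewise linear) path from `p` to `q`. -/
def IsPath : List (Seg E) → G.Point → G.Point → Prop
  | [], p, q => p = q
  | s :: γ, p, q => s.a ≤ G.len s.edge ∧ s.b ≤ G.len s.edge ∧
      G.pt s.edge s.a = p ∧ IsPath γ (G.pt s.edge s.b) q

/-- The vertex at which the oriented edge `(e, d)` starts. Here `d = true` is the direction in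
which the parameter of `e` increases, and `d = false` the opposite one. -/
def origin (ξ : E × Bool) : V := if ξ.2 then G.src ξ.1 else G.tgt ξ.1

open Classical in
/-- The outward primitive tangent vectors at a point. -/
def dirs : G.Point → Finset (E × Bool)
  | .vertex v => Finset.univ.filter fun ξ => G.origin ξ = v
  | .inner e _ _ _ => {(e, true), (e, false)}

/-- The parameter of the point `p`, seen as the starting point of the tangent vector
`ξ ∈ G.dirs p`. -/
def base : G.Point → E × Bool → ℝ≥0∞
  | .vertex _, ξ => if ξ.2 then 0 else G.len ξ.1
  | .inner _ t _ _, _ => t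

/-- The value of a 1-form that is constant along the edges on a primitive tangent vector: `ω e`
is the value on the unit vector of `e` that points in the direction of increasing parameter. -/
def formVal (ω : E → ℝ) (ξ : E × Bool) : ℝ := if ξ.2 then ω ξ.1 else -ω ξ.1

/-- The space of 1-forms: forms that are constant along the edges and balanced at every point. -/
def Omega : Submodule ℝ (E → ℝ) where
  carrier := {ω | ∀ p : G.Point, ∑ ξ ∈ G.dirs p, formVal ω ξ = 0}
  add_mem' {ω ω'} h h' p := by
    have : ∀ ξ : E × Bool, formVal (ω + ω') ξ = formVal ω ξ + formVal ω' ξ := by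
      intro ξ; simp only [formVal, Pi.add_apply]; split_ifs <;> ring
    simp only [this, Finset.sum_add_distrib, h p, h' p, add_zero]
  zero_mem' p := by simp [formVal]
  smul_mem' c ω h p := by
    have : ∀ ξ : E × Bool, formVal (c • ω) ξ = c * formVal ω ξ := by
      intro ξ; simp only [formVal, Pi.smul_apply, smul_eq_mul]; split_ifs <;> ring
    simp only [this, ← Finset.mul_sum, h p, mul_zero]

/-- The dual space of the space of 1-forms. -/
abbrev OmegaDual : Type _ := Module.Dual ℝ G.Omega

/-- The linear functional `ω ↦ ω e`. -/
def evalEdge (e : E) : G.OmegaDual := LinearMap.proj e ∘ₗ G.Omega.subtype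

/-- Integration of 1-forms along a path. (1-forms vanish on edges of infinite length, so that it
does not matter that `toReal` sends `∞` to `0`.) -/
def integral (γ : List (Seg E)) : G.OmegaDual :=
  (γ.map fun s => (s.b.toReal - s.a.toReal) • G.evalEdge s.edge).sum

open Classical in
/-- The simplicial boundary map from 1-chains to 0-chains. -/
def boundary : (E → ℤ) →ₗ[ℤ] (V → ℤ) where
  toFun n v := (∑ e with G.tgt e = v, n e) - ∑ e with G.src e = v, n e
  map_add' n m := by
    funext v; simp only [Pi.add_apply, Finset.sum_add_distrib]; ring
  map_smul' c n := by
    funext v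
    simp only [Pi.smul_apply, smul_eq_mul, ← Finset.mul_sum, RingHom.id_apply]; ring

/-- The first homology group with integer coefficients. -/
abbrev H1 : Submodule ℤ (E → ℤ) := LinearMap.ker G.boundary

/-- The genus, that is, the first Betti number. -/
def genus : ℕ := Module.finrank ℤ G.H1

/-- Integration of 1-forms over integral cycles. -/
def period : G.H1 →+ G.OmegaDual where
  toFun n := ∑ e, ((n.1 e : ℝ) * (G.len e).toReal) • G.evalEdge e
  map_zero' := by simp
  map_add' n m := by
    simp [add_mul, add_smul, Finset.sum_add_distrib]

/-- The period lattice. -/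
def lattice : AddSubgroup G.OmegaDual := G.period.range

/-- The tropical Jacobian. -/
abbrev Jacobian : Type _ := G.OmegaDual ⧸ G.lattice

/-- The length pairing of two integral cycles. (Cycles do not meet edges of infinite length.) -/
def Q (n m : G.H1) : ℝ := ∑ e, (n.1 e : ℝ) * (m.1 e : ℝ) * (G.len e).toReal

/-- The isomorphism of integral cycles with integral 1-forms induced by the length pairing: a
cycle that runs `n e` times along `e` goes to the 1-form with value `n e` along `e`. -/
def cycleForm (n : G.H1) : G.Omega := ⟨fun e => (n.1 e : ℝ), by
  classical
  intro p
  cases p with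
  | inner e t h0 h1 => simp [dirs, formVal]
  | vertex v =>
    have h : (∑ e with G.tgt e = v, n.1 e) - ∑ e with G.src e = v, n.1 e = 0 := by
      have h := congrFun (LinearMap.mem_ker.1 n.2) v
      simp only [boundary, LinearMap.coe_mk, AddHom.coe_mk, Pi.zero_apply] at h
      convert h
    have h' : (∑ e with G.tgt e = v, (n.1 e : ℝ)) - ∑ e with G.src e = v, (n.1 e : ℝ) = 0 := by
      exact_mod_cast h
    have h2 : ∑ ξ ∈ G.dirs (.vertex v), formVal (fun e => (n.1 e : ℝ)) ξ =
        ∑ ξ : E × Bool, if G.origin ξ = v then formVal (fun e => (n.1 e : ℝ)) ξ else 0 := by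
      rw [dirs, Finset.sum_filter]
    rw [h2, Fintype.sum_prod_type]
    rw [Finset.sum_filter, Finset.sum_filter, ← Finset.sum_sub_distrib] at h'
    have h3 : ∀ e, (∑ d : Bool, if G.origin (e, d) = v then
        formVal (fun e => (n.1 e : ℝ)) (e, d) else 0) =
        -((if G.tgt e = v then (n.1 e : ℝ) else 0) - if G.src e = v then (n.1 e : ℝ) else 0) := by
      intro e
      simp only [Fintype.sum_bool, origin, formVal, if_true, Bool.false_eq_true, if_false]
      split_ifs <;> ring
    rw [Finset.sum_congr rfl fun e _ => h3 e, Finset.sum_neg_distrib, h', neg_zero]⟩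

/-- `cycleForm n` represents the length pairing with `n`. -/
theorem period_cycleForm (m n : G.H1) : G.period m (G.cycleForm n) = G.Q m n := by
  simp only [period, Q, cycleForm, evalEdge, AddMonoidHom.coe_mk, ZeroHom.coe_mk,
    LinearMap.coe_sum, Finset.sum_apply, LinearMap.smul_apply, LinearMap.comp_apply,
    Submodule.subtype_apply, LinearMap.proj_apply, smul_eq_mul]
  exact Finset.sum_congr rfl fun e _ => by ring

/-- The theta function `Θ(x) = max_n (Q(n, x) - Q(n, n) / 2)`, where `n` runs over the integral
cycles and `Q(n, x) = x (cycleForm n)` is the linear extension of the length pairing with `n`. -/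
def theta (x : G.OmegaDual) : ℝ := ⨆ n : G.H1, (x (G.cycleForm n) - G.Q n n / 2)

/-- Divisors: formal integral linear combinations of points. -/
abbrev Divisor : Type _ := G.Point →₀ ℤ

/-- The degree of a divisor. -/
def degree (D : G.Divisor) : ℤ := D.sum fun _ a => a

/-- Near the parameter `a`, and on the side given by `d` (`true` for larger parameters), the
function `F` is affine, with slope `m` in the direction pointing away from `a`. -/
def HasSlope (F : ℝ≥0∞ → ℝ) (a : ℝ≥0∞) (d : Bool) (m : ℤ) : Prop :=
  if d then ∃ b, a < b ∧ ∀ x ∈ Set.Ico a b, ∀ y ∈ Set.Ico a b,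
      F y - F x = m * (y.toReal - x.toReal)
  else ∃ b, b < a ∧ ∀ x ∈ Set.Ioc b a, ∀ y ∈ Set.Ioc b a, x ≠ ⊤ → y ≠ ⊤ →
      F y - F x = -m * (y.toReal - x.toReal)

/-- The function given near `p` by its restrictions `F ξ` to the edge germs `ξ` at `p` is
piecewise affine with integral slopes, and its order at `p` (the sum of its outward slopes)
is `k`. -/
def HasOrder (F : E × Bool → ℝ≥0∞ → ℝ) (p : G.Point) (k : ℤ) : Prop :=
  ∃ m : E × Bool → ℤ, (∀ ξ ∈ G.dirs p, HasSlope (F ξ) (G.base p ξ) ξ.2 (m ξ)) ∧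
    k = ∑ ξ ∈ G.dirs p, m ξ

/-- The local lift to the universal covering `OmegaDual` of the Jacobian of the Abel-Jacobi map
near `p`, given by a path `γ` that ends at `p`: at the point with parameter `x` on the edge germ
`ξ` it is the integral along `γ` followed by the segment of that edge from `p` to `x`. -/
def localLift (γ : List (Seg E)) (p : G.Point) (ξ : E × Bool) (x : ℝ≥0∞) : G.OmegaDual :=
  G.integral (γ ++ [⟨ξ.1, G.base p ξ, x⟩])

/-- `D` is the pull-back `μ^*[Θ_lam]` of the divisor of the translated theta function
`Θ_lam(x) = Θ(x - lam)` under the Abel-Jacobi map `μ` with base point `p₀`, that is, the divisor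
of the section given locally by the functions `Θ_lam ∘ μ̂`, for all local lifts `μ̂` of `μ` and
all lifts of `lam`. -/
def IsThetaPullback (p₀ : G.Point) (lam : G.Jacobian) (D : G.Divisor) : Prop :=
  ∀ l : G.OmegaDual, (l : G.Jacobian) = lam → ∀ (p : G.Point) (γ : List (Seg E)),
    G.IsPath γ p₀ p →
      G.HasOrder (fun ξ x => G.theta (G.localLift γ p ξ x - l)) p (D p)

/-- The integrals along two paths with the same end points differ by a period. -/
theorem integral_sub_mem_lattice {p q : G.Point} {γ γ' : List (Seg E)} (h : G.IsPath γ p q)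
    (h' : G.IsPath γ' p q) : G.integral γ - G.integral γ' ∈ G.lattice := by
  classical
  let foot : G.Point → V := fun p => match p with
    | .vertex v => v
    | .inner e _ _ _ => G.src e
  let corr : G.Point → G.OmegaDual := fun p => match p with
    | .vertex _ => 0
    | .inner e t _ _ => t.toReal • G.evalEdge e
  let P : (E → ℤ) → G.OmegaDual := fun n => ∑ e, ((n e : ℝ) * (G.len e).toReal) • G.evalEdge e
  have hP : ∀ n m, P (n + m) = P n + P m := fun n m => by
    simp [P, add_mul, add_smul, Finset.sum_add_distrib]
  have hPs : ∀ e (k : ℤ), P (Pi.single e k) = ((k : ℝ) * (G.len e).toReal) • G.evalEdge e := by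
    intro e k
    simp only [P]
    rw [Finset.sum_eq_single e]
    · simp
    · intro e' _ h'; simp [Pi.single_eq_of_ne h']
    · simp
  have hb : ∀ e (k : ℤ), G.boundary (Pi.single e k) =
      Pi.single (G.tgt e) k - Pi.single (G.src e) k := by
    intro e k
    funext v
    simp only [boundary, LinearMap.coe_mk, AddHom.coe_mk, Pi.sub_apply, Finset.sum_filter,
      Pi.single_apply]
    congr 1 <;>
    · rw [Finset.sum_eq_single e]
      · simp [eq_comm]
      · intro e' _ h'; simp [h']
      · simp
  have hpt : ∀ e a, a ≤ G.len e → ∃ k : ℤ,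
      a.toReal • G.evalEdge e = corr (G.pt e a) + ((k : ℝ) * (G.len e).toReal) • G.evalEdge e ∧
      (Pi.single (foot (G.pt e a)) 1 : V → ℤ) =
        Pi.single (G.src e) 1 + (Pi.single (G.tgt e) k - Pi.single (G.src e) k) := by
    intro e a ha
    by_cases h : 0 < a ∧ a < G.len e
    · exact ⟨0, by simp [pt, h, corr], by simp [pt, h, foot]⟩
    · by_cases h0 : a = 0
      · exact ⟨0, by simp [pt, h0, corr], by simp [pt, h0, foot]⟩
      · have ha' : a = G.len e := by
          refine le_antisymm ha (not_lt.1 fun h1 => h ⟨pos_iff_ne_zero.2 h0, h1⟩)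
        subst ha'
        exact ⟨1, by simp [pt, h0, corr], by simp [pt, h0, foot]⟩
  have key : ∀ (γ : List (Seg E)) (p q : G.Point), G.IsPath γ p q → ∃ n : E → ℤ,
      G.boundary n = Pi.single (foot q) 1 - Pi.single (foot p) 1 ∧
      G.integral γ = P n + corr q - corr p := by
    intro γ
    induction γ with
    | nil =>
      rintro p q h
      obtain rfl : p = q := h
      exact ⟨0, by simp, by simp [integral, P]⟩
    | cons s γ ih =>
      rintro p q ⟨ha, hs, rfl, h⟩
      obtain ⟨n, hn, hi⟩ := ih _ _ h
      obtain ⟨k, hk, hk'⟩ := hpt _ _ ha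
      obtain ⟨j, hj, hj'⟩ := hpt _ _ hs
      refine ⟨n + (Pi.single s.edge j + Pi.single s.edge (-k)), ?_, ?_⟩
      · rw [map_add, map_add, hn, hb, hb, hk', hj', Pi.single_neg, Pi.single_neg]
        abel
      · have : G.integral (s :: γ) =
            (s.b.toReal - s.a.toReal) • G.evalEdge s.edge + G.integral γ := by
          simp [integral]
        have h1 : (s.b.toReal - s.a.toReal) • G.evalEdge s.edge =
            s.b.toReal • G.evalEdge s.edge - s.a.toReal • G.evalEdge s.edge :=
          LinearMap.ext fun ω => by simp [sub_mul]
        have h2 : (((-k : ℤ) : ℝ) * (G.len s.edge).toReal) • G.evalEdge s.edge =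
            -(((k : ℝ) * (G.len s.edge).toReal) • G.evalEdge s.edge) := by
          exact LinearMap.ext fun ω => by simp
        rw [this, hi, hP, hP, hPs, hPs, h1, h2, hj, hk]
        abel
  obtain ⟨n, hn, hi⟩ := key γ p q h
  obtain ⟨m, hm, hj⟩ := key γ' p q h'
  refine ⟨⟨n - m, by rw [LinearMap.mem_ker, map_sub, hn, hm, sub_self]⟩, ?_⟩
  have h1 : P (n - m) + P m = P n := by rw [← hP, sub_add_cancel]
  have h2 : G.integral γ - G.integral γ' = P (n - m) := by
    rw [hi, hj, ← h1]; abel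
  exact h2.symm

end MetricGraph

/-- A compact tropical curve: the geometric realization of a connected metric graph. -/
structure TropicalCurve (V E : Type*) [Fintype V] [Fintype E] extends MetricGraph V E where
  connected : ∀ p q : toMetricGraph.Point, ∃ γ, toMetricGraph.IsPath γ p q

namespace TropicalCurve

variable {V E : Type*} [Fintype V] [Fintype E] (C : TropicalCurve V E)

/-- The Abel-Jacobi map on points: integration along any path from `p₀` to `p`. -/
def abelJacobiPoint (p₀ p : C.Point) : C.Jacobian :=
  (C.integral (C.connected p₀ p).choose : C.OmegaDual)

/-- The Abel-Jacobi map does not depend on the choice of paths. -/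
theorem abelJacobiPoint_eq {p₀ p : C.Point} {γ : List (MetricGraph.Seg E)}
    (h : C.IsPath γ p₀ p) : C.abelJacobiPoint p₀ p = (C.integral γ : C.OmegaDual) := by
  rw [abelJacobiPoint, eq_comm, ← sub_eq_zero, ← QuotientAddGroup.mk_sub,
    QuotientAddGroup.eq_zero_iff]
  exact C.integral_sub_mem_lattice h (C.connected p₀ p).choose_spec

/-- The Abel-Jacobi map on divisors. -/
def abelJacobi (p₀ : C.Point) (D : C.Divisor) : C.Jacobian :=
  D.sum fun p a => a • C.abelJacobiPoint p₀ p

end TropicalCurve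

end

open scoped ENNReal

noncomputable section

namespace MetricGraph

variable {V E : Type*} [Fintype V] [Fintype E] (G : MetricGraph V E)

/-! ### Balanced forms -/

/-! Lift the Abel-Jacobi map to `OmegaDual` by choosing a value at each vertex and continuing
affinely along each edge from its source. At the target of `e` the continuation misses the chosen
value by the period of a cycle `loop e`. Summation by parts and positivity of the length pairing
show that `e ↦ loop e` is a projection of the 1-chains onto the cycles (`sum_smul_cycleForm_loop`).
Its trace `∑ e, loop e e` is therefore the genus (`sum_loop_apply`).

Along an edge, theta is a piecewise affine function of one variable, so partial summation expresses
the sum of its orders, and their first moment, by slopes and values at the two ends (`IsBreakSet`).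
Quasi-periodicity carries the data at the far end back to the chosen lift of the target
(`exists_edge_breaks`). When all edges are added, the slopes at the vertices cancel. The degree is
left with the trace. In the moment, the theta values form a coboundary, which 1-forms do not see,
and the quasi-periodicity terms in `l` add up to `l` because `e ↦ loop e` is a projection. What
remains is a constant and a period (`exists_finset_thetaOrder`).

Effectivity is convexity: the outward slopes of theta dominate those of an affine term attaining the
maximum, and the latter sum to zero because a cycle is balanced. -/

@[simp] theorem evalEdge_apply (e : E) (ω : G.Omega) : G.evalEdge e ω = ω.1 e := rfl

@[simp] theorem cycleForm_apply (n : G.H1) (e : E) : (G.cycleForm n).1 e = n.1 e := rfl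

/-- 1-forms vanish on edges of infinite length. -/
theorem omega_eq_zero_of_len_eq_top {e : E} (he : G.len e = ⊤) (ω : G.Omega) : ω.1 e = 0 := by
  classical
  have h1 := G.leaf_of_len_eq_top e he
  have hpos : 0 < {e' | G.tgt e' = G.tgt e}.ncard :=
    (Set.ncard_pos (Set.toFinite _)).2 ⟨e, rfl⟩
  have hs : {e' | G.src e' = G.tgt e} = ∅ :=
    (Set.ncard_eq_zero (Set.toFinite _)).1 (by omega)
  obtain ⟨a, ha⟩ := Set.ncard_eq_one.1 (show {e' | G.tgt e' = G.tgt e}.ncard = 1 by omega)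
  have hea : e = a := by
    have : e ∈ {e' | G.tgt e' = G.tgt e} := rfl
    rwa [ha] at this
  have hd : G.dirs (.vertex (G.tgt e)) = {(e, false)} := by
    ext ⟨e', d⟩
    cases d
    · have : G.tgt e' = G.tgt e ↔ e' = e := by
        rw [hea]; rw [hea] at ha
        exact (Set.ext_iff.1 ha e')
      rw [dirs, Finset.mem_filter]
      simp [origin, this]
    · have : ¬ G.src e' = G.tgt e := fun h => (Set.ext_iff.1 hs e').1 h
      rw [dirs, Finset.mem_filter]
      simp [origin, this]
  have := ω.2 (.vertex (G.tgt e))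
  rw [hd, Finset.sum_singleton] at this
  simpa [formVal] using this

theorem evalEdge_eq_zero {e : E} (he : G.len e = ⊤) : G.evalEdge e = 0 :=
  LinearMap.ext fun ω => G.omega_eq_zero_of_len_eq_top he ω

theorem cycle_eq_zero {e : E} (he : G.len e = ⊤) (n : G.H1) : n.1 e = 0 :=
  Int.cast_eq_zero.1 (G.omega_eq_zero_of_len_eq_top he (G.cycleForm n))

theorem sum_dirs_vertex {M : Type*} [AddCommMonoid M] (f : V → E × Bool → M) :
    ∑ v, ∑ ξ ∈ G.dirs (.vertex v), f v ξ =
      ∑ e, (f (G.src e) (e, true) + f (G.tgt e) (e, false)) := by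
  classical
  have h : ∀ v, ∑ ξ ∈ G.dirs (.vertex v), f v ξ =
      ∑ ξ : E × Bool, if G.origin ξ = v then f v ξ else 0 := fun v => by
    rw [dirs, Finset.sum_filter]
  simp_rw [h]
  rw [Finset.sum_comm, Fintype.sum_prod_type]
  simp [origin]

/-- Summation by parts: the coboundary of a function on the vertices is orthogonal to 1-forms. -/
theorem sum_mul_src_eq (c : V → ℝ) (ω : G.Omega) :
    ∑ e, c (G.src e) * ω.1 e = ∑ e, c (G.tgt e) * ω.1 e := by
  have h := G.sum_dirs_vertex fun v ξ => c v * formVal ω.1 ξ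
  have hω : ∀ p, ∑ ξ ∈ G.dirs p, formVal ω.1 ξ = 0 := ω.2
  simp_rw [← Finset.mul_sum, hω, mul_zero, Finset.sum_const_zero] at h
  simp only [formVal, if_true, Bool.false_eq_true, if_false, mul_neg,
    Finset.sum_add_distrib, Finset.sum_neg_distrib] at h
  linarith

/-- Definiteness of the length pairing. Infinite edges have weight `0` under `toReal`, but 1-forms
vanish there anyway. -/
theorem omega_eq_zero_of_sum_sq (ω : G.Omega)
    (h : ∑ e, (G.len e).toReal * (ω.1 e * ω.1 e) = 0) : ω = 0 := by
  refine Subtype.ext (funext fun e => ?_)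
  by_cases he : G.len e = ⊤
  · exact G.omega_eq_zero_of_len_eq_top he ω
  · have := (Finset.sum_eq_zero_iff_of_nonneg fun e _ =>
      mul_nonneg ENNReal.toReal_nonneg (mul_self_nonneg (ω.1 e))).1 h e (Finset.mem_univ e)
    rcases mul_eq_zero.1 this with h0 | h0
    · exact absurd h0 (ENNReal.toReal_pos (G.len_pos e).ne' he).ne'
    · exact mul_self_eq_zero.1 h0

@[simp] theorem cycleForm_add (n m : G.H1) :
    G.cycleForm (n + m) = G.cycleForm n + G.cycleForm m :=
  Subtype.ext (funext fun e => by simp [cycleForm])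

@[simp] theorem cycleForm_zero : G.cycleForm 0 = 0 :=
  Subtype.ext (funext fun e => by simp [cycleForm])

theorem period_apply (n : G.H1) (ω : G.Omega) :
    G.period n ω = ∑ e, (n.1 e : ℝ) * (G.len e).toReal * ω.1 e := by
  simp [period]

/-! ### The theta function -/

/-- The affine functions of which the theta function is the maximum. -/
def thetaTerm (y : G.OmegaDual) (n : G.H1) : ℝ := y (G.cycleForm n) - G.Q n n / 2

theorem thetaTerm_zero (y : G.OmegaDual) : G.thetaTerm y 0 = 0 := by
  simp [thetaTerm, Q]

/-- With the next lemma: the linear part of a theta term grows linearly in the cycle, the quadratic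
part quadratically, so only finitely many terms matter. -/
theorem exists_abs_apply_cycleForm_le (y : G.OmegaDual) :
    ∃ K, 0 ≤ K ∧ ∀ n : G.H1, |y (G.cycleForm n)| ≤ K * ∑ e, |(n.1 e : ℝ)| := by
  classical
  obtain ⟨z, hz⟩ := LinearMap.exists_extend (p := G.Omega) y
  refine ⟨∑ e, |z (Pi.single e 1)|, Finset.sum_nonneg fun _ _ => abs_nonneg _, fun n => ?_⟩
  have h1 : y (G.cycleForm n) = ∑ e, (n.1 e : ℝ) * z (Pi.single e 1) := by
    rw [← hz, LinearMap.comp_apply, Submodule.subtype_apply, LinearMap.pi_apply_eq_sum_univ z]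
    refine Finset.sum_congr rfl fun e _ => ?_
    rw [smul_eq_mul]
    congr 2
    funext i
    simp [Pi.single_apply, eq_comm]
  rw [h1, Finset.mul_sum]
  refine (Finset.abs_sum_le_sum_abs _ _).trans (Finset.sum_le_sum fun e _ => ?_)
  rw [abs_mul, mul_comm]
  exact mul_le_mul_of_nonneg_right
    (Finset.single_le_sum (f := fun e => |z (Pi.single e 1)|) (fun _ _ => abs_nonneg _)
      (Finset.mem_univ e)) (abs_nonneg _)

theorem exists_pos_mul_sum_sq_le_Q :
    ∃ δ : ℝ, 0 < δ ∧ ∀ n : G.H1, δ * ∑ e, |(n.1 e : ℝ)| ^ 2 ≤ G.Q n n := by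
  obtain ⟨δ, h0, h⟩ : ∃ δ : ℝ, 0 < δ ∧ ∀ e, G.len e ≠ ⊤ → δ ≤ (G.len e).toReal := by
    rcases isEmpty_or_nonempty E with hE | hE
    · exact ⟨1, one_pos, fun e => (hE.false e).elim⟩
    -- The value 1 on infinite edges keeps the minimum positive; cycles have coefficient 0 there.
    obtain ⟨e₀, h₀⟩ := Finite.exists_min fun e => if G.len e = ⊤ then 1 else (G.len e).toReal
    refine ⟨_, ?_, fun e he => (h₀ e).trans (by rw [if_neg he])⟩
    split_ifs with h
    · exact one_pos
    · exact ENNReal.toReal_pos (G.len_pos e₀).ne' h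
  refine ⟨δ, h0, fun n => ?_⟩
  rw [Finset.mul_sum, Q]
  refine Finset.sum_le_sum fun e _ => ?_
  by_cases he : G.len e = ⊤
  · simp [G.cycle_eq_zero he n]
  · rw [sq_abs, ← sq, mul_comm]
    exact mul_le_mul_of_nonneg_left (h e he) (sq_nonneg _)

/-- By Cauchy-Schwarz the ℓ¹-norm `N` satisfies `δ N² ≤ 2 |E| |K| N`, which confines the integral
cycles to a box. -/
theorem finite_setOf_Q_le (K : ℝ) :
    {n : G.H1 | G.Q n n / 2 ≤ K * ∑ e, |(n.1 e : ℝ)|}.Finite := by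
  obtain ⟨δ, h0, h⟩ := G.exists_pos_mul_sum_sq_le_Q
  have hfin : (Set.Icc (fun _ => -⌈|K| * (2 * Fintype.card E) / δ⌉ : E → ℤ)
      (fun _ => ⌈|K| * (2 * Fintype.card E) / δ⌉)).Finite := by
    classical exact Set.finite_Icc _ _
  refine (hfin.preimage (Subtype.val_injective (p := (· ∈ G.H1))).injOn).subset fun n hn => ?_
  rw [Set.mem_ofPred_eq] at hn
  set N : ℝ := ∑ e, |(n.1 e : ℝ)| with hN
  have hN0 : 0 ≤ N := Finset.sum_nonneg fun _ _ => abs_nonneg _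
  have hc : N ^ 2 ≤ Fintype.card E * ∑ e, |(n.1 e : ℝ)| ^ 2 := by
    simpa using sq_sum_le_card_mul_sum_sq (s := Finset.univ) (f := fun e => |(n.1 e : ℝ)|)
  have hNb : N ≤ |K| * (2 * Fintype.card E) / δ := by
    rw [le_div_iff₀ h0]
    rcases hN0.eq_or_lt with h' | h'
    · rw [← h', zero_mul]; positivity
    · have h1 := h n
      have h2 : (0 : ℝ) ≤ Fintype.card E := by positivity
      have h3 : K * N ≤ |K| * N := mul_le_mul_of_nonneg_right (le_abs_self K) hN0
      have h4 : δ * ∑ e, |(n.1 e : ℝ)| ^ 2 ≤ 2 * (|K| * N) := by linarith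
      have h5 : δ * N ^ 2 ≤ Fintype.card E * (2 * (|K| * N)) :=
        calc δ * N ^ 2 ≤ δ * (Fintype.card E * ∑ e, |(n.1 e : ℝ)| ^ 2) :=
              mul_le_mul_of_nonneg_left hc h0.le
          _ = Fintype.card E * (δ * ∑ e, |(n.1 e : ℝ)| ^ 2) := by ring
          _ ≤ _ := mul_le_mul_of_nonneg_left h4 h2
      refine le_of_mul_le_mul_right ?_ h'
      linarith
  have hb : ∀ e, |n.1 e| ≤ ⌈|K| * (2 * Fintype.card E) / δ⌉ := fun e => by
    have : ((|n.1 e| : ℤ) : ℝ) ≤ ⌈|K| * (2 * Fintype.card E) / δ⌉ := by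
      push_cast
      exact ((Finset.single_le_sum (f := fun e => |(n.1 e : ℝ)|) (fun _ _ => abs_nonneg _)
        (Finset.mem_univ e)).trans hNb).trans (Int.le_ceil _)
    exact_mod_cast this
  exact ⟨fun e => (abs_le.1 (hb e)).1, fun e => (abs_le.1 (hb e)).2⟩

/-- Along a segment, finitely many terms suffice to define the theta function. -/
theorem exists_finset_thetaTerm_le (y v : G.OmegaDual) : ∃ S : Finset G.H1,
    ∀ t ∈ Set.Icc (0 : ℝ) 1, ∃ n ∈ S,
      ∀ m, G.thetaTerm (y + t • v) m ≤ G.thetaTerm (y + t • v) n := by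
  obtain ⟨K, hK, hy⟩ := G.exists_abs_apply_cycleForm_le y
  obtain ⟨K', hK', hv⟩ := G.exists_abs_apply_cycleForm_le v
  -- `K + K'` controls `y + t • v` for all `t ∈ [0, 1]`; a term outside `S` is negative and loses to
  -- the zero cycle.
  let S := (G.finite_setOf_Q_le (K + K')).toFinset
  have h0 : (0 : G.H1) ∈ S := by simp [S, Q]
  refine ⟨S, fun t ht => ?_⟩
  obtain ⟨n, hn, hmax⟩ := S.exists_max_image (G.thetaTerm (y + t • v)) ⟨0, h0⟩
  refine ⟨n, hn, fun m => ?_⟩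
  by_cases hm : m ∈ S
  · exact hmax m hm
  refine le_trans ?_ (hmax 0 h0)
  rw [thetaTerm_zero, thetaTerm]
  have h1 : (K + K') * ∑ e, |(m.1 e : ℝ)| < G.Q m m / 2 := by simpa [S] using hm
  have h2 := (le_abs_self _).trans (hy m)
  have h3 := hv m
  have h4 : t * v (G.cycleForm m) ≤ |v (G.cycleForm m)| :=
    (mul_le_mul_of_nonneg_left (le_abs_self _) ht.1).trans
      (mul_le_of_le_one_left (abs_nonneg _) ht.2)
  simp only [LinearMap.add_apply, LinearMap.smul_apply, smul_eq_mul]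
  linarith [add_mul K K' (∑ e, |(m.1 e : ℝ)|)]

theorem theta_eq_of_forall_le {y : G.OmegaDual} {n : G.H1}
    (h : ∀ m, G.thetaTerm y m ≤ G.thetaTerm y n) : G.theta y = G.thetaTerm y n :=
  le_antisymm (ciSup_le h) (le_ciSup (f := G.thetaTerm y) ⟨_, by rintro _ ⟨m, rfl⟩; exact h m⟩ n)

theorem exists_forall_thetaTerm_le (y : G.OmegaDual) :
    ∃ n, ∀ m, G.thetaTerm y m ≤ G.thetaTerm y n := by
  obtain ⟨S, hS⟩ := G.exists_finset_thetaTerm_le y 0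
  obtain ⟨n, -, hn⟩ := hS 0 ⟨le_rfl, zero_le_one⟩
  exact ⟨n, by simpa using hn⟩

theorem thetaTerm_le_theta (y : G.OmegaDual) (m : G.H1) : G.thetaTerm y m ≤ G.theta y := by
  obtain ⟨n, hn⟩ := G.exists_forall_thetaTerm_le y
  exact (hn m).trans_eq (G.theta_eq_of_forall_le hn).symm

theorem exists_thetaTerm_eq_theta (y : G.OmegaDual) : ∃ n, G.thetaTerm y n = G.theta y := by
  obtain ⟨n, hn⟩ := G.exists_forall_thetaTerm_le y
  exact ⟨n, (G.theta_eq_of_forall_le hn).symm⟩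

/-- The quasi-periodicity of the theta function. -/
theorem theta_add_period (y : G.OmegaDual) (m : G.H1) :
    G.theta (y + G.period m) = G.theta y + (y (G.cycleForm m) + G.Q m m / 2) := by
  -- Completing the square: translation by a period permutes the terms, up to a summand independent
  -- of `n`.
  have key : ∀ n, G.thetaTerm (y + G.period m) (n + m) =
      G.thetaTerm y n + (y (G.cycleForm m) + G.Q m m / 2) := fun n => by
    have hQ : G.Q (n + m) (n + m) = G.Q n n + 2 * G.Q m n + G.Q m m := by
      simp only [Q, Finset.mul_sum, ← Finset.sum_add_distrib]
      refine Finset.sum_congr rfl fun e _ => ?_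
      simp only [Submodule.coe_add, Pi.add_apply, Int.cast_add]
      ring
    simp only [thetaTerm, cycleForm_add, map_add, LinearMap.add_apply, period_cycleForm, hQ]
    ring
  obtain ⟨n, hn⟩ := G.exists_forall_thetaTerm_le y
  rw [G.theta_eq_of_forall_le hn, ← key, G.theta_eq_of_forall_le]
  intro k
  have := key (k - m)
  rw [sub_add_cancel] at this
  rw [this, key]
  linarith [hn (k - m)]

/-! ### Slopes of the theta function -/

/-- The derivative of the Abel-Jacobi map in the direction of a primitive tangent vector. -/
def tangent (ξ : E × Bool) : G.OmegaDual := if ξ.2 then G.evalEdge ξ.1 else -G.evalEdge ξ.1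

theorem tangent_apply (ξ : E × Bool) (ω : G.Omega) : G.tangent ξ ω = formVal ω.1 ξ := by
  unfold tangent formVal; split_ifs <;> simp

/-- `s` is the slope of the theta function at `y` in the direction `ξ`. -/
def IsThetaSlope (y : G.OmegaDual) (ξ : E × Bool) (s : ℤ) : Prop :=
  ∃ ε : ℝ, 0 < ε ∧ ∀ t, 0 ≤ t → t < ε → G.theta (y + t • G.tangent ξ) = G.theta y + s * t

/-- Among the finitely many relevant terms that are maximal at `y`, the steepest one wins for small
`t`; terms strictly below at `y` stay below by continuity. -/
theorem exists_isThetaSlope (y : G.OmegaDual) (ξ : E × Bool) : ∃ s, G.IsThetaSlope y ξ s := by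
  classical
  obtain ⟨S, hS⟩ := G.exists_finset_thetaTerm_le y (G.tangent ξ)
  let k : G.H1 → ℤ := fun n => if ξ.2 then n.1 ξ.1 else -n.1 ξ.1
  have hk : ∀ n t, G.thetaTerm (y + t • G.tangent ξ) n = G.thetaTerm y n + k n * t := by
    intro n t
    have : formVal (G.cycleForm n).1 ξ = k n := by
      simp only [formVal, k, cycleForm_apply]; split_ifs <;> simp
    simp only [thetaTerm, LinearMap.add_apply, LinearMap.smul_apply, tangent_apply, this,
      smul_eq_mul]
    ring
  obtain ⟨n₁, hn₁S, hn₁⟩ := hS 0 ⟨le_rfl, zero_le_one⟩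
  simp only [zero_smul, add_zero] at hn₁
  obtain ⟨n₀, hn₀, hmax⟩ := (S.filter fun n => G.thetaTerm y n = G.theta y).exists_max_image k
    ⟨n₁, Finset.mem_filter.2 ⟨hn₁S, (G.theta_eq_of_forall_le hn₁).symm⟩⟩
  obtain ⟨hn₀S, hn₀⟩ := Finset.mem_filter.1 hn₀
  refine ⟨k n₀, ?_⟩
  have hev : ∀ᶠ t in nhdsWithin (0 : ℝ) (Set.Ici 0), ∀ n ∈ S,
      G.thetaTerm y n + k n * t ≤ G.thetaTerm y n₀ + k n₀ * t := by
    rw [Filter.eventually_all_finset]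
    intro n hn
    by_cases h : G.thetaTerm y n = G.theta y
    · filter_upwards [self_mem_nhdsWithin] with t ht
      have : (k n : ℝ) ≤ k n₀ := by exact_mod_cast hmax n (Finset.mem_filter.2 ⟨hn, h⟩)
      rw [h, hn₀]
      exact add_le_add_right (mul_le_mul_of_nonneg_right this ht) _
    · have hlt : G.thetaTerm y n < G.thetaTerm y n₀ :=
        hn₀ ▸ lt_of_le_of_ne (G.thetaTerm_le_theta y n) h
      have hc : ContinuousAt (fun t : ℝ => G.thetaTerm y n + k n * t) 0 := by fun_prop
      have hc' : ContinuousAt (fun t : ℝ => G.thetaTerm y n₀ + k n₀ * t) 0 := by fun_prop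
      exact ((hc.eventually_lt hc' (by simpa using hlt)).filter_mono nhdsWithin_le_nhds).mono
        fun t ht => ht.le
  have hev1 : ∀ᶠ t in nhdsWithin (0 : ℝ) (Set.Ici 0), t ≤ 1 :=
    ((eventually_lt_nhds zero_lt_one).filter_mono nhdsWithin_le_nhds).mono fun t ht => le_of_lt ht
  obtain ⟨ε, hε, h⟩ := mem_nhdsGE_iff_exists_Ico_subset.1 (hev.and hev1)
  refine ⟨ε, hε, fun t h0 h1 => ?_⟩
  obtain ⟨h2, h3⟩ := h ⟨h0, h1⟩
  obtain ⟨n, hn, hmaxn⟩ := hS t ⟨h0, h3⟩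
  rw [G.theta_eq_of_forall_le (n := n₀), hk, hn₀]
  intro m
  refine (hmaxn m).trans ?_
  rw [hk, hk]
  exact h2 n hn

/-- The slope of the theta function at `y` in the direction `ξ`. -/
def thetaSlope (y : G.OmegaDual) (ξ : E × Bool) : ℤ := (G.exists_isThetaSlope y ξ).choose

theorem isThetaSlope_thetaSlope (y : G.OmegaDual) (ξ : E × Bool) :
    G.IsThetaSlope y ξ (G.thetaSlope y ξ) := (G.exists_isThetaSlope y ξ).choose_spec

variable {G} in
theorem IsThetaSlope.unique {y : G.OmegaDual} {ξ : E × Bool} {s s' : ℤ}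
    (h : G.IsThetaSlope y ξ s) (h' : G.IsThetaSlope y ξ s') : s = s' := by
  obtain ⟨ε, h0, h⟩ := h
  obtain ⟨ε', h0', h'⟩ := h'
  have hm : 0 < min ε ε' := lt_min h0 h0'
  have h1 := h _ (half_pos hm).le ((half_lt_self hm).trans_le (min_le_left _ _))
  have h2 := h' _ (half_pos hm).le ((half_lt_self hm).trans_le (min_le_right _ _))
  have h3 : (s : ℝ) = s' := mul_right_cancel₀ (half_pos hm).ne' (by linarith)
  exact_mod_cast h3

theorem thetaSlope_eq_zero (y : G.OmegaDual) {ξ : E × Bool} (h : G.len ξ.1 = ⊤) :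
    G.thetaSlope y ξ = 0 := by
  refine (G.isThetaSlope_thetaSlope y ξ).unique ⟨1, one_pos, fun t _ _ => ?_⟩
  have : G.tangent ξ = 0 := by simp [tangent, G.evalEdge_eq_zero h]
  simp [this]

/-- Theta lies above each of its affine terms and touches this one at `y`. -/
theorem formVal_le_thetaSlope {y : G.OmegaDual} {n : G.H1} (h : G.thetaTerm y n = G.theta y)
    (ξ : E × Bool) : formVal (G.cycleForm n).1 ξ ≤ G.thetaSlope y ξ := by
  obtain ⟨ε, h0, hs⟩ := G.isThetaSlope_thetaSlope y ξ
  have h1 := hs _ (half_pos h0).le (half_lt_self h0)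
  have h2 := G.thetaTerm_le_theta (y + (ε / 2) • G.tangent ξ) n
  rw [h1, ← h] at h2
  simp only [thetaTerm, LinearMap.add_apply, LinearMap.smul_apply, tangent_apply,
    smul_eq_mul] at h2
  refine le_of_mul_le_mul_right (a := ε / 2) ?_ (half_pos h0)
  linarith

/-- The correction in `theta_add_period` is affine in `y`, with linear part given by `m`. -/
theorem thetaSlope_add_period (y : G.OmegaDual) (m : G.H1) (ξ : E × Bool) :
    G.thetaSlope (y + G.period m) ξ =
      G.thetaSlope y ξ + if ξ.2 then m.1 ξ.1 else -m.1 ξ.1 := by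
  refine (G.isThetaSlope_thetaSlope _ ξ).unique ?_
  obtain ⟨ε, h0, hs⟩ := G.isThetaSlope_thetaSlope y ξ
  refine ⟨ε, h0, fun t ht ht' => ?_⟩
  rw [add_right_comm, theta_add_period, theta_add_period, hs t ht ht', LinearMap.add_apply,
    LinearMap.smul_apply, tangent_apply]
  simp only [formVal, cycleForm_apply, smul_eq_mul, Int.cast_add]
  split_ifs <;> push_cast <;> ring

/-- The order at `p` of the theta function, lifted along a lift of the Abel-Jacobi map that
takes `p` to `y`. -/
def thetaOrder (y : G.OmegaDual) (p : G.Point) : ℤ := ∑ ξ ∈ G.dirs p, G.thetaSlope y ξ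

theorem thetaOrder_nonneg (y : G.OmegaDual) (p : G.Point) : 0 ≤ G.thetaOrder y p := by
  obtain ⟨n, hn⟩ := G.exists_thetaTerm_eq_theta y
  have h := Finset.sum_le_sum fun ξ (_ : ξ ∈ G.dirs p) => G.formVal_le_thetaSlope hn ξ
  rw [(G.cycleForm n).2 p] at h
  rw [thetaOrder]
  exact_mod_cast h

/-- The slope corrections are the values of a balanced form, so they cancel at each point. This
makes orders independent of the lifts. -/
theorem thetaOrder_add_period (y : G.OmegaDual) (m : G.H1) (p : G.Point) :
    G.thetaOrder (y + G.period m) p = G.thetaOrder y p := by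
  have h := (G.cycleForm m).2 p
  have h' : ∑ ξ ∈ G.dirs p, (if ξ.2 then m.1 ξ.1 else -m.1 ξ.1) = 0 := by
    rw [← Int.cast_inj (α := ℝ), Int.cast_zero, ← h, Int.cast_sum]
    refine Finset.sum_congr rfl fun ξ _ => ?_
    simp only [formVal, cycleForm_apply]
    split_ifs <;> simp
  simp only [thetaOrder, thetaSlope_add_period, Finset.sum_add_distrib, h', add_zero]

theorem thetaOrder_inner (y : G.OmegaDual) (e : E) (t : ℝ≥0∞) (h0 : 0 < t) (h1 : t < G.len e) :
    G.thetaOrder y (.inner e t h0 h1) =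
      G.thetaSlope y (e, true) + G.thetaSlope y (e, false) := by
  classical
  simp [thetaOrder, dirs]

end MetricGraph

/-! ### Piecewise affine functions of a real variable -/

/-- To the right of `a` the function `f` is affine with outward slope `s`. -/
def IsRightSlope (f : ℝ → ℝ) (a : ℝ) (s : ℤ) : Prop :=
  ∃ ε : ℝ, 0 < ε ∧ ∀ t, 0 ≤ t → t < ε → f (a + t) = f a + s * t

/-- To the left of `a` the function `f` is affine with outward slope `s`. -/
def IsLeftSlope (f : ℝ → ℝ) (a : ℝ) (s : ℤ) : Prop :=
  ∃ ε : ℝ, 0 < ε ∧ ∀ t, 0 ≤ t → t < ε → f (a - t) = f a + s * t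

theorem IsRightSlope.unique {f : ℝ → ℝ} {a : ℝ} {s s' : ℤ} (h : IsRightSlope f a s)
    (h' : IsRightSlope f a s') : s = s' := by
  obtain ⟨ε, h0, h⟩ := h
  obtain ⟨ε', h0', h'⟩ := h'
  have hm : 0 < min ε ε' := lt_min h0 h0'
  have h1 := h _ (half_pos hm).le ((half_lt_self hm).trans_le (min_le_left _ _))
  have h2 := h' _ (half_pos hm).le ((half_lt_self hm).trans_le (min_le_right _ _))
  have h3 : (s : ℝ) = s' := mul_right_cancel₀ (half_pos hm).ne' (by linarith)
  exact_mod_cast h3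

theorem isLeftSlope_iff {f : ℝ → ℝ} {a : ℝ} {s : ℤ} :
    IsLeftSlope f a s ↔ IsRightSlope (fun x => f (-x)) (-a) s := by
  simp only [IsLeftSlope, IsRightSlope, neg_add, neg_neg, ← sub_eq_add_neg]

theorem IsLeftSlope.unique {f : ℝ → ℝ} {a : ℝ} {s s' : ℤ} (h : IsLeftSlope f a s)
    (h' : IsLeftSlope f a s') : s = s' :=
  (isLeftSlope_iff.1 h).unique (isLeftSlope_iff.1 h')

/-- `B` contains the break points in `(a, b)` of the function `f` with outward slopes `r` and `s`,
and the sums over `B` are given by partial summation. -/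
def IsBreakSet (f : ℝ → ℝ) (r s : ℝ → ℤ) (a b : ℝ) (B : Finset ℝ) : Prop :=
  (∀ t ∈ B, a < t ∧ t < b) ∧ (∀ t, a < t → t < b → t ∉ B → r t + s t = 0) ∧
    ∑ t ∈ B, (r t + s t) = -s b - r a ∧
    ∑ t ∈ B, ((r t + s t : ℤ) : ℝ) * t = -s b * b - r a * a - (f b - f a)

/-- The term `r b + s b` of the inserted point cancels the boundary terms at `b`; it may be zero,
since `B` need only contain the breaks. -/
theorem IsBreakSet.trans {f : ℝ → ℝ} {r s : ℝ → ℤ} {a b c : ℝ} {B B' : Finset ℝ} (hab : a < b)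
    (hbc : b < c) (h : IsBreakSet f r s a b B) (h' : IsBreakSet f r s b c B') :
    IsBreakSet f r s a c (insert b (B ∪ B')) := by
  obtain ⟨h1, h2, h3, h4⟩ := h
  obtain ⟨h1', h2', h3', h4'⟩ := h'
  have hb : b ∉ B ∪ B' := fun h => (Finset.mem_union.1 h).elim
    (fun h => (h1 b h).2.false) (fun h => (h1' b h).1.false)
  have hd : Disjoint B B' := Finset.disjoint_left.2 fun t ht ht' =>
    ((h1 t ht).2.trans (h1' t ht').1).false
  refine ⟨fun t ht => ?_, fun t hat htc ht => ?_, ?_, ?_⟩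
  · rcases Finset.mem_insert.1 ht with rfl | ht
    · exact ⟨hab, hbc⟩
    rcases Finset.mem_union.1 ht with ht | ht
    · exact ⟨(h1 t ht).1, (h1 t ht).2.trans hbc⟩
    · exact ⟨hab.trans (h1' t ht).1, (h1' t ht).2⟩
  · simp only [Finset.mem_insert, Finset.mem_union, not_or] at ht
    rcases lt_or_gt_of_ne ht.1 with h | h
    · exact h2 t hat h ht.2.1
    · exact h2' t h htc ht.2.2
  · rw [Finset.sum_insert hb, Finset.sum_union hd, h3, h3']
    ring
  · rw [Finset.sum_insert hb, Finset.sum_union hd, h4, h4']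
    push_cast
    ring

theorem isBreakSet_empty_of_affine {f : ℝ → ℝ} {r s : ℝ → ℤ} (hr : ∀ a, IsRightSlope f a (r a))
    (hs : ∀ a, IsLeftSlope f a (s a)) {a b : ℝ} {k : ℤ} (hab : a < b)
    (hf : ∀ t, a ≤ t → t ≤ b → f t = f a + k * (t - a)) : IsBreakSet f r s a b ∅ := by
  have h1 : ∀ t, a ≤ t → t < b → r t = k := fun t h h' => (hr t).unique
    ⟨b - t, sub_pos.2 h', fun u hu hu' => by
      rw [hf t h h'.le, hf (t + u) (by linarith) (by linarith)]; ring⟩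
  have h2 : ∀ t, a < t → t ≤ b → s t = -k := fun t h h' => (hs t).unique
    ⟨t - a, sub_pos.2 h, fun u hu hu' => by
      rw [hf t h.le h', hf (t - u) (by linarith) (by linarith)]; push_cast; ring⟩
  refine ⟨by simp, fun t ht ht' _ => ?_, ?_, ?_⟩
  · rw [h1 t ht.le ht', h2 t ht ht'.le, add_neg_cancel]
  · rw [h1 a le_rfl hab, h2 b hab le_rfl]; simp
  · rw [h1 a le_rfl hab, h2 b hab le_rfl, hf b hab.le le_rfl]
    push_cast
    rw [Finset.sum_empty]
    ring

/-- Near `c` the function is affine on either side, so `c` is the only possible break. -/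
theorem exists_pos_isBreakSet {f : ℝ → ℝ} {r s : ℝ → ℤ} (hr : ∀ a, IsRightSlope f a (r a))
    (hs : ∀ a, IsLeftSlope f a (s a)) (c : ℝ) : ∃ δ > 0, ∀ a b, a < b → |a - c| < δ → |b - c| < δ →
    ∃ B, IsBreakSet f r s a b B := by
  obtain ⟨ε, h0, h⟩ := hr c
  obtain ⟨ε', h0', h'⟩ := hs c
  have hright : ∀ a b, a < b → c ≤ a → b - c < ε → IsBreakSet f r s a b ∅ := by
    intro a b hab hc hb
    refine isBreakSet_empty_of_affine hr hs (k := r c) hab fun t ht ht' => ?_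
    have h1 := h (t - c) (by linarith) (by linarith)
    have h2 := h (a - c) (by linarith) (by linarith)
    rw [add_sub_cancel] at h1 h2
    rw [h1, h2]; ring
  have hleft : ∀ a b, a < b → b ≤ c → c - a < ε' → IsBreakSet f r s a b ∅ := by
    intro a b hab hc hb
    refine isBreakSet_empty_of_affine hr hs (k := -s c) hab fun t ht ht' => ?_
    have h1 := h' (c - t) (by linarith) (by linarith)
    have h2 := h' (c - a) (by linarith) (by linarith)
    rw [sub_sub_cancel] at h1 h2
    rw [h1, h2]; push_cast; ring
  refine ⟨min ε ε', lt_min h0 h0', fun a b hab ha hb => ?_⟩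
  have hb' := (abs_lt.1 (hb.trans_le (min_le_left _ _))).2
  have ha' := (abs_lt.1 (ha.trans_le (min_le_right _ _))).1
  rcases le_or_gt c a with hc | hc
  · exact ⟨_, hright a b hab hc hb'⟩
  rcases le_or_gt b c with hc' | hc'
  · exact ⟨_, hleft a b hab hc' (by linarith)⟩
  · exact ⟨_, (hleft a c hc le_rfl (by linarith)).trans hc hc' (hright c b hc' le_rfl hb')⟩

/-- Compactness: subdivide the interval so that each piece lies in a ball of the local statement,
then glue. -/
theorem exists_isBreakSet {f : ℝ → ℝ} {r s : ℝ → ℤ} (hr : ∀ a, IsRightSlope f a (r a))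
    (hs : ∀ a, IsLeftSlope f a (s a)) {a b : ℝ}
    (hab : a < b) : ∃ B, IsBreakSet f r s a b B := by
  choose δ hδ h using exists_pos_isBreakSet hr hs
  obtain ⟨t, ht0, ht, ⟨m, hm⟩, hc⟩ := exists_monotone_Icc_subset_open_cover_Icc hab.le
    (c := fun x : Set.Icc a b => Metric.ball x (δ x)) (fun _ => Metric.isOpen_ball)
    (fun x _ => Set.mem_iUnion.2 ⟨x, Metric.mem_ball_self (hδ x)⟩)
  have key : ∀ n, a < t n → ∃ B, IsBreakSet f r s a (t n) B := by
    intro n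
    induction n with
    | zero => intro h; rw [ht0] at h; exact absurd h (lt_irrefl a)
    | succ n ih =>
      intro h1
      have hle : t n ≤ t (n + 1) := ht n.le_succ
      rcases hle.eq_or_lt with heq | hlt
      · rw [← heq] at h1 ⊢
        exact ih h1
      obtain ⟨x, hx⟩ := hc n
      obtain ⟨B, hB⟩ := h x (t n) (t (n + 1)) hlt (hx ⟨le_rfl, hle⟩) (hx ⟨hle, le_rfl⟩)
      rcases (t n).2.1.eq_or_lt with heq | hlt'
      · rw [← heq] at hB
        exact ⟨B, hB⟩
      · obtain ⟨B', hB'⟩ := ih hlt'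
        exact ⟨_, hB'.trans hlt' hlt hB⟩
  have := key m
  rw [hm m le_rfl] at this
  exact this hab

namespace MetricGraph

variable {V E : Type*} [Fintype V] [Fintype E] (G : MetricGraph V E)

/-! ### Orders of the pull-back of the theta function -/

theorem HasSlope.unique {F : ℝ≥0∞ → ℝ} {a : ℝ≥0∞} {d : Bool} {m m' : ℤ}
    (ha : d = true → a ≠ ⊤) (ha' : d = false → a ≠ 0) (h : HasSlope F a d m)
    (h' : HasSlope F a d m') : m = m' := by
  have key : ∀ x y : ℝ≥0∞, x < y → y ≠ ⊤ →
      (m : ℝ) * (y.toReal - x.toReal) = m' * (y.toReal - x.toReal) → m = m' := by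
    intro x y hxy hy he
    have : x.toReal < y.toReal := (ENNReal.toReal_lt_toReal hxy.ne_top hy).2 hxy
    exact_mod_cast mul_right_cancel₀ (sub_pos.2 this).ne' he
  cases d with
  | true =>
    simp only [HasSlope, if_true] at h h'
    obtain ⟨b, hb, h⟩ := h
    obtain ⟨b', hb', h'⟩ := h'
    obtain ⟨x, hx, hx'⟩ := exists_between (lt_min hb hb')
    refine key a x hx hx'.ne_top ?_
    rw [← h a ⟨le_rfl, hb⟩ x ⟨hx.le, hx'.trans_le (min_le_left _ _)⟩,
      ← h' a ⟨le_rfl, hb'⟩ x ⟨hx.le, hx'.trans_le (min_le_right _ _)⟩]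
  | false =>
    simp only [HasSlope, Bool.false_eq_true, if_false] at h h'
    obtain ⟨b, hb, h⟩ := h
    obtain ⟨b', hb', h'⟩ := h'
    -- Here `a` may be `⊤`, so two points strictly below it are compared.
    obtain ⟨x, hx, hx'⟩ := exists_between (max_lt hb hb')
    obtain ⟨y, hy, hy'⟩ := exists_between hx'
    refine key x y hy hy'.ne_top ?_
    have hbx := (le_max_left b b').trans_lt hx
    have hbx' := (le_max_right b b').trans_lt hx
    have h1 := h x ⟨hbx, hx'.le⟩ y ⟨hbx.trans hy, hy'.le⟩ hx'.ne_top hy'.ne_top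
    have h2 := h' x ⟨hbx', hx'.le⟩ y ⟨hbx'.trans hy, hy'.le⟩ hx'.ne_top hy'.ne_top
    linarith

theorem hasSlope_theta (y : G.OmegaDual) (e : E) (d : Bool) {a : ℝ≥0∞}
    (ha : d = true → a ≠ ⊤) (ha' : d = false → a ≠ 0) (hle : a ≤ G.len e) :
    HasSlope (fun x => G.theta (y + (x.toReal - a.toReal) • G.evalEdge e)) a d
      (G.thetaSlope y (e, d)) := by
  obtain ⟨ε, h0, h⟩ := G.isThetaSlope_thetaSlope y (e, d)
  cases d with
  | true =>
    have hfin := ha rfl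
    simp only [tangent, if_true] at h
    simp only [HasSlope, if_true]
    refine ⟨a + ENNReal.ofReal ε, ENNReal.lt_add_right hfin (by simpa using h0), ?_⟩
    have key : ∀ x ∈ Set.Ico a (a + ENNReal.ofReal ε),
        G.theta (y + (x.toReal - a.toReal) • G.evalEdge e) =
          G.theta y + G.thetaSlope y (e, true) * (x.toReal - a.toReal) := fun x hx => by
      refine h _ (sub_nonneg.2 (ENNReal.toReal_mono hx.2.ne_top hx.1)) ?_
      have := (ENNReal.toReal_lt_toReal hx.2.ne_top (by finiteness)).2 hx.2
      rw [ENNReal.toReal_add hfin (by finiteness), ENNReal.toReal_ofReal h0.le] at this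
      linarith
    intro x hx x' hx'
    rw [key x hx, key x' hx']
    ring
  | false =>
    have hpos := ha' rfl
    simp only [HasSlope, Bool.false_eq_true, if_false]
    -- At a point at infinity `a.toReal` is a default value, but `evalEdge e` vanishes and the
    -- function is constant.
    by_cases hfin : a = ⊤
    · have hlen : G.len e = ⊤ := top_unique (hfin ▸ hle)
      refine ⟨0, pos_iff_ne_zero.2 hpos, fun x _ x' _ _ _ => ?_⟩
      rw [G.thetaSlope_eq_zero y (ξ := (e, false)) hlen, G.evalEdge_eq_zero hlen]
      simp
    simp only [tangent, Bool.false_eq_true, if_false] at h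
    refine ⟨a - ENNReal.ofReal ε, ENNReal.sub_lt_self hfin hpos (by simpa using h0), ?_⟩
    have key : ∀ x ∈ Set.Ioc (a - ENNReal.ofReal ε) a,
        G.theta (y + (x.toReal - a.toReal) • G.evalEdge e) =
          G.theta y + G.thetaSlope y (e, false) * (a.toReal - x.toReal) := fun x hx => by
      rw [← h (a.toReal - x.toReal) (sub_nonneg.2 (ENNReal.toReal_mono hfin hx.2))]
      · rw [smul_neg, ← neg_smul, neg_sub]
      · have hx' : x ≠ ⊤ := ne_top_of_le_ne_top hfin hx.2
        have h1 : a < x + ENNReal.ofReal ε := by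
          have := ENNReal.lt_add_of_sub_lt_right (Or.inl hfin) hx.1
          exact this
        have := (ENNReal.toReal_lt_toReal hfin (by finiteness)).2 h1
        rw [ENNReal.toReal_add hx' (by finiteness), ENNReal.toReal_ofReal h0.le] at this
        linarith
    intro x hx x' hx' _ _
    rw [key x hx, key x' hx']
    ring

theorem base_spec {p : G.Point} {ξ : E × Bool} (h : ξ ∈ G.dirs p) :
    (ξ.2 = true → G.base p ξ ≠ ⊤) ∧ (ξ.2 = false → G.base p ξ ≠ 0) ∧
      G.base p ξ ≤ G.len ξ.1 := by
  cases p with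
  | vertex v =>
    obtain ⟨e, d⟩ := ξ
    cases d <;> simp [base, (G.len_pos e).ne']
  | inner e t h0 h1 =>
    have he : ξ.1 = e := by
      simp only [dirs, Finset.mem_insert, Finset.mem_singleton] at h
      rcases h with rfl | rfl <;> rfl
    exact ⟨fun _ => h1.ne_top, fun _ => h0.ne', he ▸ h1.le⟩

theorem localLift_eq (γ : List (Seg E)) (p : G.Point) (ξ : E × Bool) (x : ℝ≥0∞) :
    G.localLift γ p ξ x =
      G.integral γ + (x.toReal - (G.base p ξ).toReal) • G.evalEdge ξ.1 := by
  simp [localLift, integral]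

theorem hasOrder_theta_iff (γ : List (Seg E)) (l : G.OmegaDual) (p : G.Point) (k : ℤ) :
    G.HasOrder (fun ξ x => G.theta (G.localLift γ p ξ x - l)) p k ↔
      k = G.thetaOrder (G.integral γ - l) p := by
  have key : ∀ ξ ∈ G.dirs p, HasSlope (fun x => G.theta (G.localLift γ p ξ x - l))
      (G.base p ξ) ξ.2 (G.thetaSlope (G.integral γ - l) ξ) := fun ξ hξ => by
    obtain ⟨h1, h2, h3⟩ := G.base_spec hξ
    simp only [localLift_eq, add_sub_right_comm]
    exact G.hasSlope_theta _ ξ.1 ξ.2 h1 h2 h3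
  constructor
  · rintro ⟨m, hm, rfl⟩
    exact Finset.sum_congr rfl fun ξ hξ => HasSlope.unique (G.base_spec hξ).1
      (G.base_spec hξ).2.1 (hm ξ hξ) (key ξ hξ)
  · rintro rfl
    exact ⟨_, key, rfl⟩

theorem isPath_append {γ γ' : List (Seg E)} {p q q' : G.Point} (h : G.IsPath γ p q)
    (h' : G.IsPath γ' q q') : G.IsPath (γ ++ γ') p q' := by
  induction γ generalizing p with
  | nil =>
    obtain rfl : p = q := h
    exact h'
  | cons s γ ih => exact ⟨h.1, h.2.1, h.2.2.1, ih h.2.2.2⟩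

theorem pt_zero (e : E) : G.pt e 0 = .vertex (G.src e) := by simp [pt]

theorem pt_len (e : E) : G.pt e (G.len e) = .vertex (G.tgt e) := by
  simp [pt, (G.len_pos e).ne']

theorem pt_of_lt {e : E} {t : ℝ≥0∞} (h0 : 0 < t) (h1 : t < G.len e) :
    G.pt e t = .inner e t h0 h1 := by simp [pt, h0, h1]

end MetricGraph

namespace TropicalCurve

open MetricGraph

variable {V E : Type*} [Fintype V] [Fintype E] (C : TropicalCurve V E) (p₀ : C.Point)

/-! ### A lift of the Abel-Jacobi map -/

/-- A lift of the Abel-Jacobi map on the vertices. -/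
def vertexLift (v : V) : C.OmegaDual := C.integral (C.connected p₀ (.vertex v)).choose

/-- A lift of the Abel-Jacobi map, affine on the half-open edges. -/
def pointLift : C.Point → C.OmegaDual
  | .vertex v => C.vertexLift p₀ v
  | .inner e t _ _ => C.vertexLift p₀ (C.src e) + t.toReal • C.evalEdge e

theorem exists_isPath_vertexLift (v : V) :
    ∃ γ, C.IsPath γ p₀ (.vertex v) ∧ C.integral γ = C.vertexLift p₀ v :=
  ⟨_, (C.connected p₀ (.vertex v)).choose_spec, rfl⟩

theorem exists_isPath_src (e : E) {t : ℝ≥0∞} (ht : t ≤ C.len e) :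
    ∃ γ, C.IsPath γ p₀ (C.pt e t) ∧
      C.integral γ = C.vertexLift p₀ (C.src e) + t.toReal • C.evalEdge e := by
  obtain ⟨γ, h, h'⟩ := C.exists_isPath_vertexLift p₀ (C.src e)
  have hseg : C.IsPath [⟨e, 0, t⟩] (.vertex (C.src e)) (C.pt e t) :=
    ⟨zero_le, ht, C.pt_zero e, rfl⟩
  refine ⟨γ ++ [⟨e, 0, t⟩], C.isPath_append h hseg, ?_⟩
  simp [← h', integral]

theorem exists_isPath_pointLift (p : C.Point) :
    ∃ γ, C.IsPath γ p₀ p ∧ C.integral γ = C.pointLift p₀ p := by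
  cases p with
  | vertex v => exact C.exists_isPath_vertexLift p₀ v
  | inner e t h0 h1 => 
    have := C.exists_isPath_src p₀ e h1.le
    rwa [C.pt_of_lt h0 h1] at this

/-- Two paths lead to the target: the chosen one, and the one through the source and along `e`. -/
theorem exists_loop (e : E) : ∃ m : C.H1, C.vertexLift p₀ (C.src e) +
    (C.len e).toReal • C.evalEdge e = C.vertexLift p₀ (C.tgt e) + C.period m := by
  obtain ⟨γ, h, h'⟩ := C.exists_isPath_src p₀ e le_rfl
  obtain ⟨γ', k, k'⟩ := C.exists_isPath_vertexLift p₀ (C.tgt e)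
  rw [pt_len] at h
  obtain ⟨m, hm⟩ := C.integral_sub_mem_lattice h k
  exact ⟨m, by rw [hm, ← h', ← k']; abel⟩

/-- The cycle by which the lift of the Abel-Jacobi map jumps at the end of an edge. -/
def loop (e : E) : C.H1 := (C.exists_loop p₀ e).choose

theorem loop_spec (e : E) : C.vertexLift p₀ (C.src e) + (C.len e).toReal • C.evalEdge e =
    C.vertexLift p₀ (C.tgt e) + C.period (C.loop p₀ e) := (C.exists_loop p₀ e).choose_spec

/-- The map that sends the edge `e` to `loop e` is the identity on 1-forms. -/
theorem sum_smul_cycleForm_loop (ω : C.Omega) :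
    ∑ e, ω.1 e • C.cycleForm (C.loop p₀ e) = ω := by
  set z : C.Omega := ∑ e, ω.1 e • C.cycleForm (C.loop p₀ e) - ω with hz
  have hze : ∀ e', z.1 e' = ∑ e, ω.1 e * ((C.loop p₀ e).1 e' : ℝ) - ω.1 e' := fun e' => by
    have := congrArg (C.evalEdge e') hz
    simpa using this
  refine sub_eq_zero.1 (C.omega_eq_zero_of_sum_sq z ?_)
  -- Pair `loop_spec` with `z` and sum against `ω`: the vertex terms cancel by `sum_mul_src_eq`, so
  -- `z` is orthogonal to itself under the length pairing.
  have h1 : ∀ e, ω.1 e * C.period (C.loop p₀ e) z = C.vertexLift p₀ (C.src e) z * ω.1 e -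
      C.vertexLift p₀ (C.tgt e) z * ω.1 e + (C.len e).toReal * (ω.1 e * z.1 e) := fun e => by
    have := congrArg (fun φ : C.OmegaDual => φ z) (C.loop_spec p₀ e)
    simp only [LinearMap.add_apply, LinearMap.smul_apply, evalEdge_apply, smul_eq_mul] at this
    linear_combination -ω.1 e * this
  have h2 := Finset.sum_congr rfl fun e (_ : e ∈ Finset.univ) => h1 e
  rw [Finset.sum_add_distrib, Finset.sum_sub_distrib,
    C.sum_mul_src_eq (fun v => C.vertexLift p₀ v z), sub_self, zero_add] at h2
  simp only [period_apply, Finset.mul_sum] at h2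
  rw [Finset.sum_comm] at h2
  rw [← sub_eq_zero, ← Finset.sum_sub_distrib] at h2
  rw [← h2]
  refine Finset.sum_congr rfl fun e _ => ?_
  nth_rw 1 [hze e]
  rw [sub_mul, Finset.sum_mul, mul_sub, Finset.mul_sum]
  congr 1
  exact Finset.sum_congr rfl fun e' _ => by ring

/-- The trace of a projection is the rank of its image. -/
theorem sum_loop_apply : ∑ e, (C.loop p₀ e).1 e = C.genus := by
  classical
  let T : (E → ℤ) →ₗ[ℤ] (E → ℤ) := Fintype.linearCombination ℤ fun e => (C.loop p₀ e).1
  have hT : ∀ n, T n = ∑ e, n e • (C.loop p₀ e).1 := fun n => rfl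
  have hproj : LinearMap.IsProj C.H1 T := by
    refine ⟨fun n => ?_, fun n hn => ?_⟩
    · rw [hT]
      exact Submodule.sum_mem _ fun e _ => Submodule.smul_mem _ _ (C.loop p₀ e).2
    · funext e'
      have := congrArg (C.evalEdge e') (C.sum_smul_cycleForm_loop p₀ (C.cycleForm ⟨n, hn⟩))
      simp only [map_sum, map_smul, evalEdge_apply, cycleForm_apply, smul_eq_mul] at this
      rw [hT, Finset.sum_apply]
      simp only [Pi.smul_apply, smul_eq_mul]
      exact_mod_cast this
  have h := hproj.trace
  rw [LinearMap.trace_eq_matrix_trace ℤ (Pi.basisFun ℤ E), Matrix.trace] at h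
  rw [genus, ← h]
  refine Finset.sum_congr rfl fun e _ => ?_
  rw [Matrix.diag_apply, LinearMap.toMatrix_apply, Pi.basisFun_apply, Pi.basisFun_repr, hT,
    Finset.sum_apply, Finset.sum_eq_single e]
  · simp
  · intro e' _ h'; simp [Pi.single_eq_of_ne h']
  · simp

/-! ### The divisor of the theta function -/

/-- Another path or another lift of the class of `l` changes the argument of theta by a period, so
one lift suffices. -/
theorem isThetaPullback_iff (l : C.OmegaDual) (D : C.Divisor) :
    C.IsThetaPullback p₀ (l : C.Jacobian) D ↔
      ∀ p, D p = C.thetaOrder (C.pointLift p₀ p - l) p := by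
  constructor
  · intro h p
    obtain ⟨γ, hγ, h'⟩ := C.exists_isPath_pointLift p₀ p
    rw [← h']
    exact (C.hasOrder_theta_iff γ l p _).1 (h l rfl p γ hγ)
  · intro h l' hl p γ hγ
    obtain ⟨γ', hγ', h'⟩ := C.exists_isPath_pointLift p₀ p
    rw [hasOrder_theta_iff, h p, ← h']
    obtain ⟨m, hm⟩ := C.integral_sub_mem_lattice hγ' hγ
    obtain ⟨m', hm'⟩ := QuotientAddGroup.eq.1 hl
    rw [show C.integral γ' - l = C.integral γ - l' + C.period (m - m') by
      rw [map_sub, hm, hm']; abel, thetaOrder_add_period]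

/-- The break points of the theta function in the interior of an edge. -/
theorem exists_edge_breaks (l : C.OmegaDual) (e : E) : ∃ B : Finset ℝ,
    (∀ t ∈ B, 0 < t ∧ ENNReal.ofReal t < C.len e) ∧
    (∀ t h0 h1, t.toReal ∉ B → C.thetaOrder (C.pointLift p₀ (.inner e t h0 h1) - l)
      (.inner e t h0 h1) = 0) ∧
    ∑ t ∈ B, C.thetaOrder (C.pointLift p₀ (C.pt e (.ofReal t)) - l) (C.pt e (.ofReal t)) =
      (C.loop p₀ e).1 e - C.thetaSlope (C.vertexLift p₀ (C.src e) - l) (e, true) -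
        C.thetaSlope (C.vertexLift p₀ (C.tgt e) - l) (e, false) ∧
    ∑ t ∈ B, C.thetaOrder (C.pointLift p₀ (C.pt e (.ofReal t)) - l) (C.pt e (.ofReal t)) •
        C.pointLift p₀ (C.pt e (.ofReal t)) =
      -(C.thetaSlope (C.vertexLift p₀ (C.src e) - l) (e, true) • C.vertexLift p₀ (C.src e)) +
      ((C.loop p₀ e).1 e - C.thetaSlope (C.vertexLift p₀ (C.tgt e) - l) (e, false)) •
        (C.vertexLift p₀ (C.tgt e) + C.period (C.loop p₀ e)) -
      (C.theta (C.vertexLift p₀ (C.tgt e) - l) +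
        ((C.vertexLift p₀ (C.tgt e) - l) (C.cycleForm (C.loop p₀ e)) +
          C.Q (C.loop p₀ e) (C.loop p₀ e) / 2) -
        C.theta (C.vertexLift p₀ (C.src e) - l)) • C.evalEdge e := by
  by_cases he : C.len e = ⊤
  · refine ⟨∅, by simp, fun t h0 h1 _ => ?_, ?_, ?_⟩
    · rw [thetaOrder_inner, C.thetaSlope_eq_zero _ he, C.thetaSlope_eq_zero _ he, add_zero]
    · rw [C.cycle_eq_zero he, C.thetaSlope_eq_zero _ he, C.thetaSlope_eq_zero _ he]; simp
    · rw [C.cycle_eq_zero he, C.thetaSlope_eq_zero _ he, C.thetaSlope_eq_zero _ he,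
        C.evalEdge_eq_zero he]; simp
  set y := C.vertexLift p₀ (C.src e) - l with hy
  set L := (C.len e).toReal with hL
  have hL0 : 0 < L := ENNReal.toReal_pos (C.len_pos e).ne' he
  obtain ⟨B, hB1, hB2, hB3, hB4⟩ := exists_isBreakSet
    (f := fun t => C.theta (y + t • C.evalEdge e))
    (r := fun t => C.thetaSlope (y + t • C.evalEdge e) (e, true))
    (s := fun t => C.thetaSlope (y + t • C.evalEdge e) (e, false))
    (fun a => by
      obtain ⟨ε, h0, h⟩ := C.isThetaSlope_thetaSlope (y + a • C.evalEdge e) (e, true)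
      refine ⟨ε, h0, fun t ht ht' => ?_⟩
      rw [← h t ht ht', tangent, if_pos rfl, add_assoc, ← add_smul])
    (fun a => by
      obtain ⟨ε, h0, h⟩ := C.isThetaSlope_thetaSlope (y + a • C.evalEdge e) (e, false)
      refine ⟨ε, h0, fun t ht ht' => ?_⟩
      rw [← h t ht ht', tangent, if_neg Bool.false_ne_true, smul_neg, ← neg_smul, add_assoc,
        ← add_smul, ← sub_eq_add_neg]) hL0
  have hlt : ∀ t, 0 < t → t < L → 0 < ENNReal.ofReal t ∧ ENNReal.ofReal t < C.len e :=
    fun t h0 h1 => ⟨ENNReal.ofReal_pos.2 h0, (ENNReal.ofReal_lt_iff_lt_toReal h0.le he).2 h1⟩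
  have hlift : ∀ t ∈ B, C.pointLift p₀ (C.pt e (.ofReal t)) =
      C.vertexLift p₀ (C.src e) + t • C.evalEdge e := fun t ht => by
    obtain ⟨h0, h1⟩ := hB1 t ht
    rw [C.pt_of_lt (hlt t h0 h1).1 (hlt t h0 h1).2, pointLift, ENNReal.toReal_ofReal h0.le]
  have hord : ∀ t ∈ B, C.thetaOrder (C.pointLift p₀ (C.pt e (.ofReal t)) - l)
      (C.pt e (.ofReal t)) = C.thetaSlope (y + t • C.evalEdge e) (e, true) +
        C.thetaSlope (y + t • C.evalEdge e) (e, false) := fun t ht => by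
    obtain ⟨h0, h1⟩ := hB1 t ht
    rw [hlift t ht, C.pt_of_lt (hlt t h0 h1).1 (hlt t h0 h1).2, thetaOrder_inner,
      add_sub_right_comm]
  have hend : y + L • C.evalEdge e =
      C.vertexLift p₀ (C.tgt e) - l + C.period (C.loop p₀ e) := by
    rw [hy, ← add_sub_right_comm, loop_spec, add_sub_right_comm]
  -- The jump of the lift at the target contributes the coefficient of `loop e` along `e`, which is
  -- the source of the genus.
  have hslope : C.thetaSlope (y + L • C.evalEdge e) (e, false) =
      C.thetaSlope (C.vertexLift p₀ (C.tgt e) - l) (e, false) - (C.loop p₀ e).1 e := by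
    rw [hend, thetaSlope_add_period, if_neg Bool.false_ne_true, ← sub_eq_add_neg]
  simp only [zero_smul, add_zero, hslope, mul_zero, sub_zero] at hB3 hB4
  refine ⟨B, fun t ht => ⟨(hB1 t ht).1, (hlt t (hB1 t ht).1 (hB1 t ht).2).2⟩,
    fun t h0 h1 ht => ?_, ?_, ?_⟩
  · have := hB2 t.toReal (ENNReal.toReal_pos h0.ne' h1.ne_top)
      ((ENNReal.toReal_lt_toReal h1.ne_top he).2 h1) ht
    rw [thetaOrder_inner, pointLift, add_sub_right_comm]
    exact this
  · rw [Finset.sum_congr rfl hord, hB3]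
    ring
  · rw [hend, theta_add_period] at hB4
    refine LinearMap.ext fun ω => ?_
    have h1 : ∀ t ∈ B, (C.thetaOrder (C.pointLift p₀ (C.pt e (.ofReal t)) - l)
        (C.pt e (.ofReal t)) • C.pointLift p₀ (C.pt e (.ofReal t))) ω =
        ((C.thetaSlope (y + t • C.evalEdge e) (e, true) +
          C.thetaSlope (y + t • C.evalEdge e) (e, false) : ℤ) : ℝ) *
            C.vertexLift p₀ (C.src e) ω +
        ((C.thetaSlope (y + t • C.evalEdge e) (e, true) +
          C.thetaSlope (y + t • C.evalEdge e) (e, false) : ℤ) : ℝ) * t * ω.1 e := fun t ht => by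
      rw [hord t ht, hlift t ht]
      simp only [LinearMap.smul_apply, LinearMap.add_apply, zsmul_eq_mul, smul_eq_mul,
        evalEdge_apply]
      ring
    have h2 := congrArg (fun φ : C.OmegaDual => φ ω) (C.loop_spec p₀ e)
    simp only [LinearMap.add_apply, LinearMap.smul_apply, evalEdge_apply, smul_eq_mul] at h2
    rw [LinearMap.sum_apply, Finset.sum_congr rfl h1, Finset.sum_add_distrib, ← Finset.sum_mul,
      ← Finset.sum_mul, hB4, ← Int.cast_sum, hB3]
    simp only [LinearMap.sub_apply, LinearMap.add_apply, LinearMap.neg_apply,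
      LinearMap.smul_apply, zsmul_eq_mul, smul_eq_mul, evalEdge_apply]
    push_cast
    -- The coefficient is minus the left slope at `L`, which multiplies the lift at the far end of
    -- the edge.
    linear_combination ((C.loop p₀ e).1 e -
      C.thetaSlope (C.vertexLift p₀ (C.tgt e) - l) (e, false) : ℝ) * h2

end TropicalCurve

/-! ### Sums over the vertices and the interior break points -/

namespace MetricGraph

variable {V E : Type*} [Fintype V] [Fintype E] (G : MetricGraph V E)

open Classical in
/-- The set of all vertices and of the points with parameters in `B e` on every edge `e`. -/
def pointSet (B : E → Finset ℝ) : Finset G.Point :=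
  Finset.univ.image .vertex ∪
    Finset.univ.biUnion fun e => (B e).image fun t => G.pt e (.ofReal t)

theorem sum_pointSet {M : Type*} [AddCommMonoid M] {B : E → Finset ℝ}
    (hB : ∀ e, ∀ t ∈ B e, 0 < t ∧ ENNReal.ofReal t < G.len e) (f : G.Point → M) :
    ∑ p ∈ G.pointSet B, f p =
      ∑ v, f (.vertex v) + ∑ e, ∑ t ∈ B e, f (G.pt e (.ofReal t)) := by
  classical
  have hpt : ∀ e, ∀ t ∈ B e, ∃ h0 h1, G.pt e (.ofReal t) = .inner e (.ofReal t) h0 h1 :=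
    fun e t ht => ⟨_, _, G.pt_of_lt (ENNReal.ofReal_pos.2 (hB e t ht).1) (hB e t ht).2⟩
  rw [pointSet, Finset.sum_union, Finset.sum_biUnion]
  · congr 1
    · exact Finset.sum_image fun v _ w _ h => Point.vertex.inj h
    · refine Finset.sum_congr rfl fun e _ => Finset.sum_image fun t ht t' ht' h => ?_
      obtain ⟨h0, h1, h2⟩ := hpt e t ht
      obtain ⟨h0', h1', h2'⟩ := hpt e t' ht'
      simp only [h2, h2', Point.inner.injEq, true_and] at h
      exact (ENNReal.ofReal_eq_ofReal_iff (hB e t ht).1.le (hB e t' ht').1.le).1 h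
  · intro e _ e' _ hee
    refine Finset.disjoint_left.2 fun p hp hp' => hee ?_
    obtain ⟨t, ht, rfl⟩ := Finset.mem_image.1 hp
    obtain ⟨t', ht', h⟩ := Finset.mem_image.1 hp'
    obtain ⟨h0, h1, h2⟩ := hpt e t ht
    obtain ⟨h0', h1', h2'⟩ := hpt e' t' ht'
    simp only [h2, h2', Point.inner.injEq] at h
    exact h.1.symm
  · refine Finset.disjoint_left.2 fun p hp hp' => ?_
    obtain ⟨v, -, rfl⟩ := Finset.mem_image.1 hp
    obtain ⟨e, -, he⟩ := Finset.mem_biUnion.1 hp'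
    obtain ⟨t, ht, h⟩ := Finset.mem_image.1 he
    obtain ⟨h0, h1, h2⟩ := hpt e t ht
    rw [h2] at h
    cases h

theorem vertex_mem_pointSet (B : E → Finset ℝ) (v : V) : .vertex v ∈ G.pointSet B := by
  simp [pointSet]

theorem inner_mem_pointSet {B : E → Finset ℝ} {e : E} {t : ℝ≥0∞} (h0 : 0 < t)
    (h1 : t < G.len e) (ht : t.toReal ∈ B e) : .inner e t h0 h1 ∈ G.pointSet B := by
  classical
  refine Finset.mem_union_right _ (Finset.mem_biUnion.2 ⟨e, Finset.mem_univ e,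
    Finset.mem_image.2 ⟨_, ht, ?_⟩⟩)
  rw [ENNReal.ofReal_toReal h1.ne_top, G.pt_of_lt h0 h1]

end MetricGraph

/-! ### Global summation: degree and Abel-Jacobi sum -/

namespace TropicalCurve

open MetricGraph

variable {V E : Type*} [Fintype V] [Fintype E] (C : TropicalCurve V E) (p₀ : C.Point)

/-- A lift of the constant of the Jacobi inversion theorem, up to sign. -/
def inversionConstant : C.OmegaDual :=
  ∑ e, ((C.loop p₀ e).1 e • C.vertexLift p₀ (C.tgt e) -
    (C.vertexLift p₀ (C.tgt e) (C.cycleForm (C.loop p₀ e)) +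
      C.Q (C.loop p₀ e) (C.loop p₀ e) / 2) • C.evalEdge e)

/-- The orders of the pull-back of the theta function vanish outside a finite set of points. They
add up to the genus, and the weighted sum of the points is determined modulo periods. -/
theorem exists_finset_thetaOrder (l : C.OmegaDual) : ∃ P : Finset C.Point,
    (∀ p, C.thetaOrder (C.pointLift p₀ p - l) p ≠ 0 → p ∈ P) ∧
    ∑ p ∈ P, C.thetaOrder (C.pointLift p₀ p - l) p = C.genus ∧
    ∃ N : C.H1, ∑ p ∈ P, C.thetaOrder (C.pointLift p₀ p - l) p • C.pointLift p₀ p =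
      l + C.inversionConstant p₀ + C.period N := by
  choose B hB1 hB2 hB3 hB4 using C.exists_edge_breaks p₀ l
  refine ⟨C.pointSet B, fun p hp => ?_, ?_, ?_⟩
  · cases p with
    | vertex v => exact C.vertex_mem_pointSet B v
    | inner e t h0 h1 =>
      by_contra h
      exact hp (hB2 e t h0 h1 fun ht => h (C.inner_mem_pointSet h0 h1 ht))
  · rw [C.sum_pointSet hB1, Finset.sum_congr rfl fun e _ => hB3 e]
    simp only [pointLift, thetaOrder]
    rw [C.sum_dirs_vertex fun v ξ => C.thetaSlope (C.vertexLift p₀ v - l) ξ,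
      ← Finset.sum_add_distrib, ← C.sum_loop_apply p₀]
    exact Finset.sum_congr rfl fun e _ => by ring
  -- `N` collects the period terms of `hB4`.
  · refine ⟨∑ e, ((C.loop p₀ e).1 e - C.thetaSlope (C.vertexLift p₀ (C.tgt e) - l) (e, false)) •
      C.loop p₀ e, ?_⟩
    rw [C.sum_pointSet hB1, Finset.sum_congr rfl fun e _ => hB4 e]
    simp only [pointLift, thetaOrder, Finset.sum_smul]
    rw [C.sum_dirs_vertex fun v ξ =>
      C.thetaSlope (C.vertexLift p₀ v - l) ξ • C.vertexLift p₀ v, ← Finset.sum_add_distrib,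
      map_sum, inversionConstant, add_assoc, ← Finset.sum_add_distrib, ← sub_eq_iff_eq_add,
      ← sub_eq_zero]
    refine LinearMap.ext fun ω => ?_
    -- `h1` removes the theta values at the vertices; `h2` identifies the terms linear in `l` with
    -- `l ω`.
    have h1 := C.sum_mul_src_eq (fun v => C.theta (C.vertexLift p₀ v - l)) ω
    have h2 := congrArg l (C.sum_smul_cycleForm_loop p₀ ω)
    simp only [map_sum, map_smul, smul_eq_mul] at h2
    simp only [LinearMap.sub_apply, LinearMap.sum_apply, LinearMap.zero_apply]
    rw [← h2, ← Finset.sum_sub_distrib, ← Finset.sum_sub_distrib, ← sub_eq_zero.2 h1,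
      ← Finset.sum_sub_distrib]
    refine Finset.sum_congr rfl fun e _ => ?_
    simp only [LinearMap.add_apply, LinearMap.sub_apply, LinearMap.neg_apply,
      LinearMap.smul_apply, map_zsmul, zsmul_eq_mul, smul_eq_mul, evalEdge_apply]
    push_cast
    ring

end TropicalCurve

end

/-! ### The inversion theorem -/

theorem mainTheorem2 {V E : Type*} [Fintype V] [Fintype E] (C : TropicalCurve V E)
    (p₀ : C.Point) :
    (∀ lam : C.Jacobian, ∃! D : C.Divisor, C.IsThetaPullback p₀ lam D) ∧
    (∀ (lam : C.Jacobian) (D : C.Divisor), C.IsThetaPullback p₀ lam D →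
      (∀ p, 0 ≤ D p) ∧ C.degree D = C.genus) ∧
    ∃ κ : C.Jacobian, ∀ (lam : C.Jacobian) (D : C.Divisor), C.IsThetaPullback p₀ lam D →
      C.abelJacobi p₀ D + κ = lam := by
  refine ⟨fun lam => ?_, fun lam D hD => ?_, -(C.inversionConstant p₀ : C.OmegaDual),
    fun lam D hD => ?_⟩
  all_goals
    obtain ⟨l, rfl⟩ := QuotientAddGroup.mk_surjective lam
    obtain ⟨P, hP, hdeg, N, hN⟩ := C.exists_finset_thetaOrder p₀ l
  -- The order function is itself the divisor; uniqueness holds because every multiplicity is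
  -- prescribed.
  · refine ⟨Finsupp.onFinset P _ hP, (C.isThetaPullback_iff p₀ l _).2 fun p => rfl,
      fun D hD => Finsupp.ext fun p => (C.isThetaPullback_iff p₀ l D).1 hD p⟩
  · rw [C.isThetaPullback_iff] at hD
    refine ⟨fun p => hD p ▸ C.thetaOrder_nonneg _ p, ?_⟩
    rw [← hdeg, MetricGraph.degree, Finsupp.sum_of_support_subset (s := P)]
    · exact Finset.sum_congr rfl fun p _ => hD p
    · exact fun p hp => hP p (hD p ▸ Finsupp.mem_support_iff.1 hp)
    · exact fun _ _ => rfl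
  · rw [C.isThetaPullback_iff] at hD
    have h1 : C.abelJacobi p₀ D = ((∑ p ∈ P, C.thetaOrder (C.pointLift p₀ p - l) p •
        C.pointLift p₀ p : C.OmegaDual) : C.Jacobian) := by
      rw [TropicalCurve.abelJacobi, Finsupp.sum_of_support_subset (s := P)]
      · rw [← QuotientAddGroup.mk'_apply, map_sum]
        refine Finset.sum_congr rfl fun p _ => ?_
        obtain ⟨γ, hγ, h⟩ := C.exists_isPath_pointLift p₀ p
        rw [C.abelJacobiPoint_eq hγ, h, hD, map_zsmul, QuotientAddGroup.mk'_apply]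
      · exact fun p hp => hP p (hD p ▸ Finsupp.mem_support_iff.1 hp)
      · exact fun _ _ => zero_smul _ _
    have h2 : ((C.period N : C.OmegaDual) : C.Jacobian) = 0 :=
      (QuotientAddGroup.eq_zero_iff _).2 ⟨N, rfl⟩
    rw [h1, hN, QuotientAddGroup.mk_add, QuotientAddGroup.mk_add, h2, add_zero,
      add_neg_cancel_right]
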